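/- For a permutation $\pi$ of $[n]=\{1,\dots,n\}$ write each cycle with its smallest entry first. An entry $c_m$ of a cycle $(c_1,\dots,c_\ell)$ of $\pi$ with $2\le m\le \ell-1$ is a cyclic peak if $c_{m-1}<c_m>c_{m+1}$ and a cyclic valley if $c_{m-1}>c_m<c_{m+1}$. Let $\mathrm{cpk}(\pi)$, $\mathrm{cval}(\pi)$, $\mathrm{cyc}(\pi)$, $\mathrm{fix}(\pi)$ be the numbers of cyclic peaks, cyclic valleys, cycles (fixed points included) and fixed points of $\pi$, and put $$P_n(q,x,y)=\sum_{\pi\in\mathfrak S_n}q^{\mathrm{cpk}(\pi)}x^{\mathrm{cyc}(\pi)}y^{\mathrm{fix}(\pi)},\qquad V_n(q,x,y)=\sum_{\pi\in\mathfrak S_n}q^{\mathrm{cval}(\pi)}x^{\mathrm{cyc}(\pi)}y^{\mathrm{fix}(\pi)}$$ for $n\ge 0$ (so $P_0=V_0=1$). At $y=0$ (with $0^0=1$) only the derangements contribute. Let $$P=P(q,x,0,z)=\sum_{n\ge0}P_n(q,x,0)\frac{z^n}{n!},\qquad V=V(q,x,0,z)=\sum_{n\ge0}V_n(q,x,0)\frac{z^n}{n!}.$$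 (1) As formal power series in $z$ over $\mathbb Q[q,x]$, $P$ and $V$ satisfy $$(1-qz)\frac{\partial P}{\partial z}+2q(q-1)\frac{\partial P}{\partial q}+x(q-1)\frac{\partial P}{\partial x}=xzP,$$ $$(1-qz)\frac{\partial V}{\partial z}+2q(q-1)\frac{\partial V}{\partial q}+2x(q-1)\frac{\partial V}{\partial x}=xzV,$$ and each is the only solution in $\mathbb Q[q,x][[z]]$ of its equation with constant term $1$ (that is, value $1$ at $z=0$). (2) Let $q,x\in\mathbb C$ with $q\ne0$ and $q\neq 1$, and let $\sqrt q$ and $\sqrt{q-1}$ be any complex square roots of $q$ and $q-1$, the same one at each occurrence. Then for all complex $z$ in a neighbourhood of $0$ the two series converge, and $$P(q,x,0,z)=e^{-xz}\biggl[\biggl(\frac{\sqrt q-1}{\sqrt q+1}\biggr)\biggl(\frac{\sqrt q+\cos(z\sqrt{q-1})+\sqrt{q-1}\,\sin(z\sqrt{q-1})}{\sqrt q-\cos(z\sqrt{q-1})-\sqrt{q-1}\,\sin(z\sqrt{q-1})}\biggr)\biggr]^{\frac{x}{2\sqrt q}},$$ $$V(q,x,0,z)=e^{-xz/q}\biggl(\frac{\sqrt{q-1}}{\sqrt{q-1}\,\cos(z\sqrt{q-1})-\sin(z\sqrt{q-1})}\biggr)^{\frac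 xq}.$$ The powers are principal values; their bases equal $1$ at $z=0$. -/

import Mathlib

open Filter Topology

namespace CyclicStat

variable {n : ℕ}

/-- `a` is the smallest entry of the cycle of `π` containing it, that is, the entry written first
in that cycle in the standard cycle decomposition. The ground set `{1, …, n}` is modelled by
`Fin n`, with the same order. -/
def IsFirst (π : Equiv.Perm (Fin n)) (a : Fin n) : Prop :=
  ∀ b, π.SameCycle a b → a ≤ b

instance (π : Equiv.Perm (Fin n)) : DecidablePred (IsFirst π) := fun a =>
  inferInstanceAs (Decidable (∀ b, π.SameCycle a b → a ≤ b))

/-- `a` is neither the first nor the last entry of its cycle `(c₁, …, cₗ)`, written with its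
smallest entry first: `a = cₘ` with `2 ≤ m ≤ l - 1`. The successor of the last entry is `c₁`. -/
def IsInner (π : Equiv.Perm (Fin n)) (a : Fin n) : Prop :=
  ¬ IsFirst π a ∧ ¬ IsFirst π (π a)

instance (π : Equiv.Perm (Fin n)) : DecidablePred (IsInner π) := fun a =>
  inferInstanceAs (Decidable (¬ IsFirst π a ∧ ¬ IsFirst π (π a)))

/-- The number of cyclic peaks: entries `cₘ` with `2 ≤ m ≤ l - 1` and `cₘ₋₁ < cₘ > cₘ₊₁` in their
cycle `(c₁, …, cₗ)`, where `cₘ₋₁ = π⁻¹ cₘ` and `cₘ₊₁ = π cₘ`. -/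
def cpk (π : Equiv.Perm (Fin n)) : ℕ :=
  (Finset.univ.filter fun a => IsInner π a ∧ π⁻¹ a < a ∧ π a < a).card

/-- The number of cyclic valleys: entries `cₘ` with `2 ≤ m ≤ l - 1` and `cₘ₋₁ > cₘ < cₘ₊₁`. -/
def cval (π : Equiv.Perm (Fin n)) : ℕ :=
  (Finset.univ.filter fun a => IsInner π a ∧ a < π⁻¹ a ∧ a < π a).card

/-- The number of cycles (fixed points included). -/
noncomputable def cyc (π : Equiv.Perm (Fin n)) : ℕ :=
  Nat.card (Quotient (Equiv.Perm.SameCycle.setoid π))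

/-- The number of fixed points. -/
def fix (π : Equiv.Perm (Fin n)) : ℕ :=
  (Finset.univ.filter fun a => π a = a).card

/-- `P_n(q, x, y) = ∑ q ^ cpk π * x ^ cyc π * y ^ fix π` over the permutations `π` of `n` letters,
with `q, x, y` in any commutative ring (indeterminates or numbers); `0 ^ 0 = 1`. -/
noncomputable def P {R : Type*} [CommRing R] (n : ℕ) (q x y : R) : R :=
  ∑ π : Equiv.Perm (Fin n), q ^ cpk π * x ^ cyc π * y ^ fix π

/-- `V_n(q, x, y) = ∑ q ^ cval π * x ^ cyc π * y ^ fix π` over the permutations `π` of `n`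
letters. -/
noncomputable def V {R : Type*} [CommRing R] (n : ℕ) (q x y : R) : R :=
  ∑ π : Equiv.Perm (Fin n), q ^ cval π * x ^ cyc π * y ^ fix π

/-- The ring `ℚ[q, x]`. -/
abbrev Coeff : Type := MvPolynomial (Fin 2) ℚ

/-- The indeterminate `q`. -/
noncomputable abbrev qv : Coeff := MvPolynomial.X 0

/-- The indeterminate `x`. -/
noncomputable abbrev xv : Coeff := MvPolynomial.X 1

/-- `P(q, x, 0, z) = ∑ P_n(q, x, 0) z ^ n / n!` in `ℚ[q, x]⟦z⟧`. -/
noncomputable def peakEGF : PowerSeries Coeff :=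
  PowerSeries.mk fun n => (1 / (n.factorial : ℚ)) • P n qv xv 0

/-- `V(q, x, 0, z) = ∑ V_n(q, x, 0) z ^ n / n!` in `ℚ[q, x]⟦z⟧`. -/
noncomputable def valleyEGF : PowerSeries Coeff :=
  PowerSeries.mk fun n => (1 / (n.factorial : ℚ)) • V n qv xv 0

/-- `∂F/∂z`. -/
noncomputable def dz (F : PowerSeries Coeff) : PowerSeries Coeff :=
  PowerSeries.derivative Coeff F

/-- `∂F/∂q`, taken coefficient by coefficient. -/
noncomputable def dq (F : PowerSeries Coeff) : PowerSeries Coeff :=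
  PowerSeries.mk fun n => MvPolynomial.pderiv 0 (PowerSeries.coeff n F)

/-- `∂F/∂x`, taken coefficient by coefficient. -/
noncomputable def dx (F : PowerSeries Coeff) : PowerSeries Coeff :=
  PowerSeries.mk fun n => MvPolynomial.pderiv 1 (PowerSeries.coeff n F)

/-- `(1 - q z) ∂F/∂z + 2 q (q - 1) ∂F/∂q + x (q - 1) ∂F/∂x = x z F`. -/
def PeakPDE (F : PowerSeries Coeff) : Prop :=
  (1 - PowerSeries.C qv * PowerSeries.X) * dz F
    + PowerSeries.C (2 * qv * (qv - 1)) * dq F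
    + PowerSeries.C (xv * (qv - 1)) * dx F
    = PowerSeries.C xv * PowerSeries.X * F

/-- `(1 - q z) ∂F/∂z + 2 q (q - 1) ∂F/∂q + 2 x (q - 1) ∂F/∂x = x z F`. -/
def ValleyPDE (F : PowerSeries Coeff) : Prop :=
  (1 - PowerSeries.C qv * PowerSeries.X) * dz F
    + PowerSeries.C (2 * qv * (qv - 1)) * dq F
    + PowerSeries.C (2 * xv * (qv - 1)) * dx F
    = PowerSeries.C xv * PowerSeries.X * F

end CyclicStat

namespace CyclicStat

open Equiv.Perm

variable {n : ℕ}

/-! A new largest letter either becomes a fixed point or is inserted just before a letter `i`.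
Insertion before a fixed point leaves `cpk` and `cval` unchanged and destroys that fixed point.
Insertion before any other letter raises the statistic by 0 or 1, and the number of places of the
first kind is `2 c + b (cyc - fix)`, with `b = 1` for `cpk` and `b = 2` for `cval`
(`IsInsertionStat`). Since `q ^ c * x ^ cyc` is an eigenvector of `2 q ∂/∂q + b x ∂/∂x` with
eigenvalue `2 c + b cyc`, summation gives a recursion for the polynomials counting permutations by
fixed points (`IsInsertionStat.fixSum_succ`). For derangements the recursion involves permutations
with exactly one fixed point; removing that point (`IsInsertionStat.natCast_mul_fixSum`) closes it,
and it becomes the differential equation. Uniqueness holds because the equation determines each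
coefficient in `z` from the earlier ones.

For the closed forms, the series `w = cos (r z) - sin (r z) / r`, `r ^ 2 = q - 1`, satisfies `pdeOp
b w = -w`. As `pdeOp b` is a derivation with a simple commutator with `∂/∂z`, it multiplies the
defects `w F' - x (1 - w) F` (peaks) and `q w F' + x (w + w') F` (valleys) by a polynomial of the
form `u + x z`. Both defects have constant term 0, so uniqueness makes them vanish: `F` satisfies a
first order linear equation in `z` alone. There `q` and `x` can be specialised to complex numbers,
and the Taylor series of the closed form satisfies the same equation with the same constant term. -/

/-! ### Insertion of a largest letter: cycles and fixed points. -/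

/-- Permutations of `n + 1` letters arise from those of `n` letters by letting the new largest
letter be a fixed point (`none`), or inserting it just before `i` in a cycle (`some i`). -/
def insertLast (n : ℕ) : Option (Fin n) × Equiv.Perm (Fin n) ≃ Equiv.Perm (Fin (n + 1)) :=
  decomposeOption.symm.trans finSuccEquivLast.symm.permCongr

@[simp] theorem insertLast_none_last (π : Equiv.Perm (Fin n)) :
    insertLast n (none, π) (Fin.last n) = Fin.last n := by
  simp [insertLast, Equiv.permCongr_apply]

@[simp] theorem insertLast_none_castSucc (π : Equiv.Perm (Fin n)) (a : Fin n) :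
    insertLast n (none, π) a.castSucc = (π a).castSucc := by
  simp [insertLast, Equiv.permCongr_apply]

@[simp] theorem insertLast_some_last (π : Equiv.Perm (Fin n)) (i : Fin n) :
    insertLast n (some i, π) (Fin.last n) = i.castSucc := by
  simp [insertLast, Equiv.permCongr_apply]

theorem insertLast_some_castSucc (π : Equiv.Perm (Fin n)) (i a : Fin n) :
    insertLast n (some i, π) a.castSucc = if π a = i then Fin.last n else (π a).castSucc := by
  by_cases h : π a = i
  · simp [insertLast, Equiv.permCongr_apply, h]
  · simp [insertLast, Equiv.permCongr_apply, h, Equiv.swap_apply_of_ne_of_ne]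

@[simp] theorem insertLast_none_inv_last (π : Equiv.Perm (Fin n)) :
    (insertLast n (none, π))⁻¹ (Fin.last n) = Fin.last n := by
  rw [inv_eq_iff_eq]; simp

@[simp] theorem insertLast_none_inv_castSucc (π : Equiv.Perm (Fin n)) (a : Fin n) :
    (insertLast n (none, π))⁻¹ a.castSucc = (π⁻¹ a).castSucc := by
  rw [inv_eq_iff_eq]; simp

@[simp] theorem insertLast_some_inv_last (π : Equiv.Perm (Fin n)) (i : Fin n) :
    (insertLast n (some i, π))⁻¹ (Fin.last n) = (π⁻¹ i).castSucc := by
  rw [inv_eq_iff_eq]; simp [insertLast_some_castSucc]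

theorem insertLast_some_inv_castSucc (π : Equiv.Perm (Fin n)) (i a : Fin n) :
    (insertLast n (some i, π))⁻¹ a.castSucc =
      if a = i then Fin.last n else (π⁻¹ a).castSucc := by
  rw [inv_eq_iff_eq]
  split_ifs with h <;> simp [insertLast_some_castSucc, h]

theorem sameCycle_map {α β : Type*} {σ : Equiv.Perm α} {τ : Equiv.Perm β} (f : α → β)
    (hf : ∀ a, τ.SameCycle (f a) (f (σ a))) {a b : α} (h : σ.SameCycle a b) :
    τ.SameCycle (f a) (f b) := by
  have hpow : ∀ (k : ℕ) (c : α), τ.SameCycle (f c) (f ((σ ^ k) c)) := by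
    intro k
    induction k with
    | zero => intro c; simp [SameCycle.refl]
    | succ k ih =>
      intro c
      rw [pow_succ, mul_apply]
      exact (hf c).trans (ih (σ c))
  obtain ⟨k, rfl⟩ := h
  obtain ⟨m, rfl | rfl⟩ := k.eq_nat_or_neg
  · simpa using hpow m a
  · have := hpow m ((σ ^ (-(m : ℤ))) a)
    simpa using this.symm

theorem sameCycle_insertLast_none (π : Equiv.Perm (Fin n)) (a b : Fin n) :
    (insertLast n (none, π)).SameCycle a.castSucc b.castSucc ↔ π.SameCycle a b := by
  constructor
  · intro h
    have := sameCycle_map (τ := π) (σ := insertLast n (none, π))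
      (Fin.lastCases (motive := fun _ => Fin n) a id) (fun c => by
        induction c using Fin.lastCases with
        | last => simp [SameCycle.refl]
        | cast c => simp [SameCycle.refl]) h
    simpa using this
  · exact sameCycle_map Fin.castSucc fun c => by
      rw [← insertLast_none_castSucc]; simp [-insertLast_none_castSucc, SameCycle.refl]

/-- Collapsing the new letter onto `i` maps orbits to orbits, since the new letter only subdivides
the arrow into `i`; conversely each old arrow becomes one or two new ones. -/
theorem sameCycle_insertLast_some (π : Equiv.Perm (Fin n)) (i a b : Fin n) :
    (insertLast n (some i, π)).SameCycle a.castSucc b.castSucc ↔ π.SameCycle a b := by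
  constructor
  · intro h
    have := sameCycle_map (τ := π) (σ := insertLast n (some i, π))
      (Fin.lastCases (motive := fun _ => Fin n) i id) (fun c => by
        induction c using Fin.lastCases with
        | last => simp [SameCycle.refl]
        | cast c =>
          rw [insertLast_some_castSucc]
          split_ifs with hc
          · subst hc; simp [SameCycle.refl]
          · simp [SameCycle.refl]) h
    simpa using this
  · refine sameCycle_map Fin.castSucc fun c => ?_
    by_cases hc : π c = i
    · refine ⟨2, ?_⟩
      simp [zpow_ofNat, pow_two, insertLast_some_castSucc, hc]
    · refine ⟨1, ?_⟩
      simp [insertLast_some_castSucc, hc]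

theorem isFirst_insertLast_none_castSucc (π : Equiv.Perm (Fin n)) (a : Fin n) :
    IsFirst (insertLast n (none, π)) a.castSucc ↔ IsFirst π a := by
  constructor
  · intro h b hb
    simpa using h _ ((sameCycle_insertLast_none π a b).2 hb)
  · intro h b hb
    induction b using Fin.lastCases with
    | last => exact Fin.le_last _
    | cast b => simpa using h b ((sameCycle_insertLast_none π a b).1 hb)

theorem isFirst_insertLast_none_last (π : Equiv.Perm (Fin n)) :
    IsFirst (insertLast n (none, π)) (Fin.last n) := by
  rintro b ⟨k, rfl⟩
  rw [zpow_apply_eq_self_of_apply_eq_self (insertLast_none_last π)]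

theorem isFirst_insertLast_some_castSucc (π : Equiv.Perm (Fin n)) (i a : Fin n) :
    IsFirst (insertLast n (some i, π)) a.castSucc ↔ IsFirst π a := by
  constructor
  · intro h b hb
    simpa using h _ ((sameCycle_insertLast_some π i a b).2 hb)
  · intro h b hb
    induction b using Fin.lastCases with
    | last => exact Fin.le_last _
    | cast b => simpa using h b ((sameCycle_insertLast_some π i a b).1 hb)

theorem not_isFirst_insertLast_some_last (π : Equiv.Perm (Fin n)) (i : Fin n) :
    ¬ IsFirst (insertLast n (some i, π)) (Fin.last n) := by
  intro h
  have := h i.castSucc ⟨1, by simp⟩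
  exact absurd (Fin.castSucc_lt_last i) (not_lt.2 this)

/-- Each cycle has exactly one smallest entry. This turns `cyc` into a sum over letters, which
splits under insertion. -/
theorem cyc_eq_sum (π : Equiv.Perm (Fin n)) : cyc π = ∑ a, if IsFirst π a then 1 else 0 := by
  rw [← Finset.card_filter, ← Fintype.card_subtype, ← Nat.card_eq_fintype_card, cyc]
  refine (Nat.card_congr (Equiv.ofBijective
    (fun a : {a // IsFirst π a} => (Quotient.mk (SameCycle.setoid π) a.1)) ⟨?_, ?_⟩)).symm
  · rintro ⟨a, ha⟩ ⟨b, hb⟩ h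
    have hab : π.SameCycle a b := Quotient.exact h
    exact Subtype.ext (le_antisymm (ha b hab) (hb a hab.symm))
  · intro c
    induction c using Quotient.inductionOn with
    | h a =>
      obtain ⟨b, hb, hmin⟩ := (Set.toFinite {b | π.SameCycle a b}).exists_minimal ⟨a, .refl _ _⟩
      refine ⟨⟨b, fun d hd => ?_⟩, Quotient.sound (SameCycle.symm hb)⟩
      exact (le_total b d).elim id fun h => hmin (SameCycle.trans hb hd) h

theorem cyc_insertLast_none (π : Equiv.Perm (Fin n)) :
    cyc (insertLast n (none, π)) = cyc π + 1 := by
  simp [-Finset.sum_boole, cyc_eq_sum, Fin.sum_univ_castSucc, isFirst_insertLast_none_castSucc,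
    isFirst_insertLast_none_last]

theorem cyc_insertLast_some (π : Equiv.Perm (Fin n)) (i : Fin n) :
    cyc (insertLast n (some i, π)) = cyc π := by
  simp [-Finset.sum_boole, cyc_eq_sum, Fin.sum_univ_castSucc, isFirst_insertLast_some_castSucc,
    not_isFirst_insertLast_some_last]

theorem fix_eq_sum (π : Equiv.Perm (Fin n)) : fix π = ∑ a, if π a = a then 1 else 0 := by
  rw [fix, Finset.card_filter]

theorem fix_insertLast_none (π : Equiv.Perm (Fin n)) :
    fix (insertLast n (none, π)) = fix π + 1 := by
  simp [-Finset.sum_boole, fix_eq_sum, Fin.sum_univ_castSucc]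

theorem fix_insertLast_some (π : Equiv.Perm (Fin n)) (i : Fin n) :
    fix (insertLast n (some i, π)) + (if π i = i then 1 else 0) = fix π := by
  have h : ∀ a, (if insertLast n (some i, π) a.castSucc = a.castSucc then 1 else 0)
      + (if a = i then (if π a = a then 1 else 0) else 0) = if π a = a then 1 else 0 := by
    intro a
    rw [insertLast_some_castSucc]
    by_cases h1 : a = i
    · subst h1
      by_cases h2 : π a = a <;> simp [h2, (Fin.castSucc_lt_last a).ne']
    · by_cases h2 : π a = i
      · have h3 : π a ≠ a := fun h => h1 (h.symm.trans h2)
        simp [h1, h2, (Fin.castSucc_lt_last a).ne', Ne.symm h1]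
      · simp [h1, h2]
  rw [fix_eq_sum, fix_eq_sum, ← Finset.sum_congr rfl fun a _ => h a, Finset.sum_add_distrib]
  simp [-Finset.sum_boole, Fin.sum_univ_castSucc, (Fin.castSucc_lt_last i).ne]

/-! ### Peaks, valleys and cyclic local maxima under insertion. -/

/-- A count over the letters not adjacent to the place just before `i`. -/
theorem sum_not_adjacent (π : Equiv.Perm (Fin n)) (i : Fin n) (Q : Fin n → Prop)
    [DecidablePred Q] (hQ : ∀ a, Q a → π a ≠ a) :
    (∑ a, if Q a ∧ a ≠ i ∧ π a ≠ i then 1 else 0) + ((if Q i then 1 else 0)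
      + if Q (π⁻¹ i) then 1 else 0) = ∑ a, if Q a then 1 else 0 := by
  have h : ∀ a, (if Q a ∧ a ≠ i ∧ π a ≠ i then 1 else 0) + ((if a = i then if Q a then 1 else 0
      else 0) + (if a = π⁻¹ i then if Q a then 1 else 0 else 0)) = if Q a then 1 else 0 := by
    intro a
    have e : a = π⁻¹ i ↔ π a = i := by rw [eq_inv_iff_eq]
    by_cases hq : Q a
    · have := hQ a hq
      by_cases h1 : a = i
      · subst h1
        simp only [e, this, hq, ne_eq, not_true_eq_false, false_and, and_false, if_true, if_false]
      · by_cases h2 : π a = i <;>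
          simp only [e, h1, h2, hq, ne_eq, not_true_eq_false, not_false_eq_true, and_self,
            and_false, if_true, if_false]
    · simp [hq]
  rw [← Finset.sum_congr rfl fun a _ => h a, Finset.sum_add_distrib, Finset.sum_add_distrib]
  simp

/-- `a` is a cyclic peak. -/
def IsPeak (π : Equiv.Perm (Fin n)) (a : Fin n) : Prop := IsInner π a ∧ π⁻¹ a < a ∧ π a < a

instance (π : Equiv.Perm (Fin n)) : DecidablePred (IsPeak π) := fun a =>
  inferInstanceAs (Decidable (IsInner π a ∧ π⁻¹ a < a ∧ π a < a))

/-- `a` is larger than both its neighbours in its cycle, read cyclically. -/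
def IsLocalMax (π : Equiv.Perm (Fin n)) (a : Fin n) : Prop := π⁻¹ a < a ∧ π a < a

instance (π : Equiv.Perm (Fin n)) : DecidablePred (IsLocalMax π) := fun a =>
  inferInstanceAs (Decidable (π⁻¹ a < a ∧ π a < a))

/-- The number of local maxima of the cycles, read cyclically. -/
def localMax (π : Equiv.Perm (Fin n)) : ℕ := ∑ a, if IsLocalMax π a then 1 else 0

theorem cpk_eq_sum (π : Equiv.Perm (Fin n)) : cpk π = ∑ a, if IsPeak π a then 1 else 0 := by
  rw [cpk, Finset.card_filter]
  rfl

theorem isLocalMax_insertLast_some_castSucc (π : Equiv.Perm (Fin n)) (i a : Fin n) :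
    IsLocalMax (insertLast n (some i, π)) a.castSucc ↔ IsLocalMax π a ∧ a ≠ i ∧ π a ≠ i := by
  rw [IsLocalMax, insertLast_some_castSucc, insertLast_some_inv_castSucc]
  by_cases h1 : a = i
  · simp [h1, (Fin.castSucc_lt_last _).le]
  by_cases h2 : π a = i <;> simp [-Equiv.Perm.coe_inv, IsLocalMax, h1, h2, (Fin.castSucc_lt_last _).le]

theorem isPeak_insertLast_some_castSucc (π : Equiv.Perm (Fin n)) (i a : Fin n) :
    IsPeak (insertLast n (some i, π)) a.castSucc ↔ IsPeak π a ∧ a ≠ i ∧ π a ≠ i := by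
  have := isLocalMax_insertLast_some_castSucc π i a
  unfold IsPeak
  unfold IsLocalMax at this
  rw [this, IsInner, IsInner, isFirst_insertLast_some_castSucc, insertLast_some_castSucc]
  by_cases h2 : π a = i
  · simp [h2]
  · simp only [h2, if_false, isFirst_insertLast_some_castSucc]; tauto

theorem isLocalMax_insertLast_none_castSucc (π : Equiv.Perm (Fin n)) (a : Fin n) :
    IsLocalMax (insertLast n (none, π)) a.castSucc ↔ IsLocalMax π a := by
  simp [-Equiv.Perm.coe_inv, IsLocalMax]

theorem isPeak_insertLast_none_castSucc (π : Equiv.Perm (Fin n)) (a : Fin n) :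
    IsPeak (insertLast n (none, π)) a.castSucc ↔ IsPeak π a := by
  simp [-Equiv.Perm.coe_inv, IsPeak, IsInner, isFirst_insertLast_none_castSucc]

theorem cpk_insertLast_none (π : Equiv.Perm (Fin n)) :
    cpk (insertLast n (none, π)) = cpk π := by
  simp [-Finset.sum_boole, cpk_eq_sum, Fin.sum_univ_castSucc, isPeak_insertLast_none_castSucc]
  simp [IsPeak, IsInner, isFirst_insertLast_none_last]

theorem localMax_insertLast_none (π : Equiv.Perm (Fin n)) :
    localMax (insertLast n (none, π)) = localMax π := by
  simp [-Finset.sum_boole, localMax, Fin.sum_univ_castSucc, isLocalMax_insertLast_none_castSucc]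
  simp [IsLocalMax]

/-- The new letter exceeds both neighbours, so it is a peak unless it ends its cycle, which happens
when `i` is first. Its neighbours `π⁻¹ i` and `i` cease to be peaks; no other letter is affected. -/
theorem cpk_insertLast_some (π : Equiv.Perm (Fin n)) (i : Fin n) :
    cpk (insertLast n (some i, π)) + ((if IsPeak π i then 1 else 0)
      + if IsPeak π (π⁻¹ i) then 1 else 0) = cpk π + if IsFirst π i then 0 else 1 := by
  have hl : IsPeak (insertLast n (some i, π)) (Fin.last n) ↔ ¬ IsFirst π i := by
    simp [IsPeak, IsInner, isFirst_insertLast_some_castSucc, not_isFirst_insertLast_some_last,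
      Fin.castSucc_lt_last]
  rw [cpk_eq_sum, cpk_eq_sum, Fin.sum_univ_castSucc, ← sum_not_adjacent π i (IsPeak π)
    fun a ha => ha.2.2.ne]
  simp only [isPeak_insertLast_some_castSucc, hl]
  split_ifs <;> omega

theorem localMax_insertLast_some (π : Equiv.Perm (Fin n)) (i : Fin n) :
    localMax (insertLast n (some i, π)) + ((if IsLocalMax π i then 1 else 0)
      + if IsLocalMax π (π⁻¹ i) then 1 else 0) = localMax π + 1 := by
  have hl : IsLocalMax (insertLast n (some i, π)) (Fin.last n) := by
    simp [IsLocalMax, Fin.castSucc_lt_last]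
  rw [localMax, localMax, Fin.sum_univ_castSucc, ← sum_not_adjacent π i (IsLocalMax π)
    fun a ha => ha.2.ne]
  simp only [isLocalMax_insertLast_some_castSucc, hl, if_true]
  omega

theorem sum_inv_apply {M : Type*} [AddCommMonoid M] (π : Equiv.Perm (Fin n)) (f : Fin n → M) :
    ∑ a, f (π⁻¹ a) = ∑ a, f a :=
  Equiv.sum_comp π⁻¹ f

/-- Descents into and ascents out of a letter are equinumerous, by reindexing along `π`. Removing
double ascents from both counts leaves the maxima and the minima. -/
theorem localMax_eq_localMin (π : Equiv.Perm (Fin n)) :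
    localMax π = ∑ a, if a < π⁻¹ a ∧ a < π a then 1 else 0 := by
  have h1 : ∀ a, (if IsLocalMax π a then 1 else 0) + (if π⁻¹ a < a ∧ a < π a then 1 else 0)
      = if π⁻¹ a < a then 1 else 0 := by
    intro a
    by_cases h : π⁻¹ a < a
    · have h' : π a ≠ a := fun e => h.ne (inv_eq_iff_eq.2 e.symm)
      rcases lt_or_gt_of_ne h' with h2 | h2 <;> simp [-Equiv.Perm.coe_inv, IsLocalMax, h, h2, h2.le]
    · simp [-Equiv.Perm.coe_inv, IsLocalMax, h]
  have h2 : ∀ a, (if a < π⁻¹ a ∧ a < π a then 1 else 0) + (if π⁻¹ a < a ∧ a < π a then 1 else 0)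
      = if a < π a then 1 else 0 := by
    intro a
    by_cases h : a < π a
    · have h' : π⁻¹ a ≠ a := fun e => h.ne (inv_eq_iff_eq.1 e)
      rcases lt_or_gt_of_ne h' with h2 | h2 <;> simp [-Equiv.Perm.coe_inv, h, h2, h2.le]
    · simp [h]
  have h3 : ∑ a, (if π⁻¹ a < a then 1 else 0) = ∑ a, if a < π a then 1 else 0 := by
    simpa [-Finset.sum_boole] using sum_inv_apply π fun a => if a < π a then 1 else 0
  have h4 := Finset.sum_congr rfl fun a (_ : a ∈ Finset.univ) => h1 a
  have h5 := Finset.sum_congr rfl fun a (_ : a ∈ Finset.univ) => h2 a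
  rw [Finset.sum_add_distrib] at h4 h5
  rw [localMax]
  omega

theorem IsFirst.of_apply_eq {π : Equiv.Perm (Fin n)} {a : Fin n} (h : π a = a) : IsFirst π a := by
  rintro b ⟨k, rfl⟩
  rw [zpow_apply_eq_self_of_apply_eq_self h]

/-- The cyclic local minima are the valleys together with the first entries of the `cyc - fix`
nontrivial cycles, and they are as many as the local maxima. Thus `cval` is handled through
`localMax`, whose insertion rule has no exception for first entries. -/
theorem cval_add_cyc (π : Equiv.Perm (Fin n)) : cval π + cyc π = localMax π + fix π := by
  rw [localMax_eq_localMin, cyc_eq_sum, fix_eq_sum, cval, Finset.card_filter,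
    ← Finset.sum_add_distrib, ← Finset.sum_add_distrib]
  refine Finset.sum_congr rfl fun a _ => ?_
  by_cases hf : π a = a
  · simp [hf, IsFirst.of_apply_eq hf]
  by_cases h1 : IsFirst π a
  · have h2 : a < π a := lt_of_le_of_ne (h1 _ ⟨1, by simp⟩) (Ne.symm hf)
    have h3 : a < π⁻¹ a := lt_of_le_of_ne (h1 _ ⟨-1, by simp⟩) fun e => hf (eq_inv_iff_eq.1 e)
    simp [-Equiv.Perm.coe_inv, h1, h2, h3, hf, IsInner]
  · have h2 : a < π a → ¬ IsFirst π (π a) := fun h hF =>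
      absurd (hF a ⟨-1, by simp⟩) (not_le.2 h)
    have : (IsInner π a ∧ a < π⁻¹ a ∧ a < π a) ↔ (a < π⁻¹ a ∧ a < π a) := by
      simp only [IsInner]; tauto
    simp [-Equiv.Perm.coe_inv, h1, hf, this]

/-- The way in which `cpk` (`b = 1`) and `cval` (`b = 2`) change when a new largest letter is
inserted. -/
structure IsInsertionStat (b : ℕ) (c : ∀ {n : ℕ}, Equiv.Perm (Fin n) → ℕ) : Prop where
  zero : ∀ π : Equiv.Perm (Fin 0), c π = 0
  none : ∀ {n : ℕ} (π : Equiv.Perm (Fin n)), c (insertLast n (none, π)) = c π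
  fixed : ∀ {n : ℕ} (π : Equiv.Perm (Fin n)) (i : Fin n), π i = i →
    c (insertLast n (some i, π)) = c π
  moved : ∀ {n : ℕ} (π : Equiv.Perm (Fin n)) (i : Fin n), π i ≠ i →
    c (insertLast n (some i, π)) = c π ∨ c (insertLast n (some i, π)) = c π + 1
  count : ∀ {n : ℕ} (π : Equiv.Perm (Fin n)),
    (∑ i, if π i ≠ i ∧ c (insertLast n (some i, π)) = c π then 1 else 0) + b * fix π
      = 2 * c π + b * cyc π

/-- The peak number is unchanged exactly before a peak, just after a peak, or before a first entry.
These cases are disjoint, as adjacent letters are never both peaks, and give `2 cpk + cyc` places,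
among them the fixed points. -/
theorem isInsertionStat_cpk : IsInsertionStat 1 @cpk where
  zero π := by simp [cpk]
  none := cpk_insertLast_none
  fixed π i h := by
    have := cpk_insertLast_some π i
    have h' : π⁻¹ i = i := inv_eq_iff_eq.2 h.symm
    simpa [h', IsFirst.of_apply_eq h, IsPeak] using this
  moved π i h := by
    have := cpk_insertLast_some π i
    have h1 : IsPeak π i → ¬ IsPeak π (π⁻¹ i) := fun h h' => by
      have := h'.2.2; simp at this; exact absurd h.2.1 this.not_gt
    have h2 : IsFirst π i → ¬ IsPeak π i := fun h h' => h'.1.1 h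
    have h3 : IsFirst π i → ¬ IsPeak π (π⁻¹ i) := fun h h' => h'.1.2 (by simpa using h)
    split_ifs at this <;> first | omega | tauto
  count {n} π := by
    have key : ∀ i, (if π i ≠ i ∧ cpk (insertLast n (some i, π)) = cpk π then 1 else 0)
        + (if π i = i then 1 else 0) = (if IsPeak π i then 1 else 0)
          + (if IsPeak π (π⁻¹ i) then 1 else 0) + if IsFirst π i then 1 else 0 := by
      intro i
      have := cpk_insertLast_some π i
      have h1 : IsPeak π i → ¬ IsPeak π (π⁻¹ i) := fun h h' => by
        have := h'.2.2; simp at this; exact absurd h.2.1 this.not_gt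
      have h2 : IsFirst π i → ¬ IsPeak π i := fun h h' => h'.1.1 h
      have h3 : IsFirst π i → ¬ IsPeak π (π⁻¹ i) := fun h h' => h'.1.2 (by simpa using h)
      by_cases hf : π i = i
      · have hF := IsFirst.of_apply_eq hf
        simp [-Equiv.Perm.coe_inv, hf, hF, h2 hF, h3 hF]
      · by_cases hF : IsFirst π i
        · simp [-Equiv.Perm.coe_inv, hF, h2 hF, h3 hF] at this ⊢; simp [hf, this]
        · by_cases hp : IsPeak π i
          · simp only [hF, hp, h1 hp, if_true, if_false] at this ⊢
            rw [if_pos ⟨hf, by omega⟩, if_neg hf]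
          · by_cases hp' : IsPeak π (π⁻¹ i)
            · simp only [hF, hp, hp', if_true, if_false] at this ⊢
              rw [if_pos ⟨hf, by omega⟩, if_neg hf]
            · simp only [hF, hp, hp', if_false] at this ⊢
              rw [if_neg (by omega), if_neg hf]
    have h4 := Finset.sum_congr rfl fun a (_ : a ∈ Finset.univ) => key a
    simp only [Finset.sum_add_distrib] at h4
    rw [sum_inv_apply π fun i => if IsPeak π i then 1 else 0, ← fix_eq_sum, ← cyc_eq_sum,
      ← cpk_eq_sum] at h4
    omega

/-- By `cval_add_cyc`, the valley number is unchanged at a non-fixed `i` exactly when `i` or `π⁻¹ i`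
is a local maximum, giving `2 localMax = 2 (cval + cyc - fix)` places. -/
theorem isInsertionStat_cval : IsInsertionStat 2 @cval where
  zero π := by simp [cval]
  none π := by
    have h1 := cval_add_cyc π
    have h2 := cval_add_cyc (insertLast _ (none, π))
    rw [cyc_insertLast_none, localMax_insertLast_none, fix_insertLast_none] at h2
    omega
  fixed π i h := by
    have h1 := cval_add_cyc π
    have h2 := cval_add_cyc (insertLast _ (some i, π))
    have h3 := localMax_insertLast_some π i
    have h4 := fix_insertLast_some π i
    have h' : π⁻¹ i = i := inv_eq_iff_eq.2 h.symm
    rw [cyc_insertLast_some] at h2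
    simp [h', IsLocalMax, h] at h3 h4
    omega
  moved π i h := by
    have h1 := cval_add_cyc π
    have h2 := cval_add_cyc (insertLast _ (some i, π))
    have h3 := localMax_insertLast_some π i
    have h4 := fix_insertLast_some π i
    have h5 : IsLocalMax π i → ¬ IsLocalMax π (π⁻¹ i) := fun h h' => by
      have := h'.2; simp at this; exact absurd h.1 this.not_gt
    rw [cyc_insertLast_some] at h2
    rw [if_neg h] at h4
    split_ifs at h3 <;> first | omega | tauto
  count {n} π := by
    have h1 := cval_add_cyc π
    have key : ∀ i, (if π i ≠ i ∧ cval (insertLast n (some i, π)) = cval π then 1 else 0)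
        = (if IsLocalMax π i then 1 else 0) + (if IsLocalMax π (π⁻¹ i) then 1 else 0) := by
      intro i
      have h2 := cval_add_cyc (insertLast _ (some i, π))
      have h3 := localMax_insertLast_some π i
      have h4 := fix_insertLast_some π i
      have h5 : IsLocalMax π i → ¬ IsLocalMax π (π⁻¹ i) := fun h h' => by
        have := h'.2; simp at this; exact absurd h.1 this.not_gt
      rw [cyc_insertLast_some] at h2
      by_cases hf : π i = i
      · have h' : π⁻¹ i = i := inv_eq_iff_eq.2 hf.symm
        simp [h', IsLocalMax, hf]
      · rw [if_neg hf] at h4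
        by_cases hp : IsLocalMax π i
        · simp only [hp, h5 hp, if_true, if_false] at h3 ⊢
          rw [if_pos ⟨hf, by omega⟩]
        · by_cases hp' : IsLocalMax π (π⁻¹ i)
          · simp only [hp, hp', if_true, if_false] at h3 ⊢
            rw [if_pos ⟨hf, by omega⟩]
          · simp only [hp, hp', if_false] at h3 ⊢
            rw [if_neg (by omega)]
    rw [Finset.sum_congr rfl fun a _ => key a, Finset.sum_add_distrib,
      sum_inv_apply π fun i => if IsLocalMax π i then 1 else 0, ← localMax]
    omega

/-! ### Recursion by number of fixed points. -/

open MvPolynomial (pderiv)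

/-- The sum of `q ^ c π * x ^ cyc π` over the permutations `π` with `j` fixed points. -/
noncomputable def fixSum (c : ∀ {n : ℕ}, Equiv.Perm (Fin n) → ℕ) (n j : ℕ) : Coeff :=
  ∑ π : Equiv.Perm (Fin n), if fix π = j then qv ^ c π * xv ^ cyc π else 0

/-- `fixSum` with the number of fixed points shifted by one. -/
noncomputable def fixSumPred (c : ∀ {n : ℕ}, Equiv.Perm (Fin n) → ℕ) (n j : ℕ) : Coeff :=
  ∑ π : Equiv.Perm (Fin n), if fix π + 1 = j then qv ^ c π * xv ^ cyc π else 0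

theorem fixSumPred_zero (c : ∀ {n : ℕ}, Equiv.Perm (Fin n) → ℕ) (n : ℕ) :
    fixSumPred c n 0 = 0 := by
  simp [fixSumPred]

theorem fixSumPred_succ (c : ∀ {n : ℕ}, Equiv.Perm (Fin n) → ℕ) (n j : ℕ) :
    fixSumPred c n (j + 1) = fixSum c n j := by
  simp [fixSumPred, fixSum]

/-- The differential operator `(1 - q) (2 q ∂/∂q + b x ∂/∂x)`. -/
noncomputable def euler (b : ℕ) (f : Coeff) : Coeff :=
  (1 - qv) * (2 * qv * pderiv 0 f + b * (xv * pderiv 1 f))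

theorem euler_sum {ι : Type*} (b : ℕ) (s : Finset ι) (f : ι → Coeff) :
    euler b (∑ i ∈ s, f i) = ∑ i ∈ s, euler b (f i) := by
  simp only [euler, map_sum, Finset.mul_sum, ← Finset.sum_add_distrib, mul_add]

theorem euler_natCast_mul (b k : ℕ) (f : Coeff) : euler b (k * f) = k * euler b f := by
  simp only [euler, Derivation.leibniz, Derivation.map_natCast, smul_eq_mul]
  ring

theorem euler_xv_mul (b : ℕ) (f : Coeff) :
    euler b (xv * f) = xv * euler b f + b * (1 - qv) * xv * f := by
  simp only [euler, Derivation.leibniz, smul_eq_mul, MvPolynomial.pderiv_X_self,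
    MvPolynomial.pderiv_X_of_ne (show (1 : Fin 2) ≠ 0 by decide)]
  ring

theorem euler_qsmul (b : ℕ) (a : ℚ) (f : Coeff) : euler b (a • f) = a • euler b f := by
  simp only [euler, MvPolynomial.smul_eq_C_mul, MvPolynomial.pderiv_C_mul]
  ring

theorem euler_monomial (b c k : ℕ) : euler b (qv ^ c * xv ^ k) =
    (1 - qv) * (2 * c + b * k) * (qv ^ c * xv ^ k) := by
  simp only [euler, Derivation.leibniz, Derivation.leibniz_pow, smul_eq_mul, nsmul_eq_mul,
    MvPolynomial.pderiv_X_self, MvPolynomial.pderiv_X_of_ne (show (1 : Fin 2) ≠ 0 by decide),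
    MvPolynomial.pderiv_X_of_ne (show (0 : Fin 2) ≠ 1 by decide)]
  -- The Leibniz rule yields the truncated exponents `c - 1` and `k - 1`, so exponent 0 is treated
  -- separately.
  rcases c with _ | c <;> rcases k with _ | k <;> simp <;> ring

section

variable {b : ℕ} {c : ∀ {n : ℕ}, Equiv.Perm (Fin n) → ℕ}

/-- With `G` the number of non-fixed places leaving `c` unchanged, these places contribute the
factor `G (1 - q) + (n - fix π) q`. Substituting `G = 2 c + b cyc - b fix` produces the Euler
operator and the correction in `j`. -/
theorem IsInsertionStat.sum_insertLast (hc : IsInsertionStat b c) {n : ℕ}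
    (π : Equiv.Perm (Fin n)) (j : ℕ) :
    (∑ o : Option (Fin n), if fix (insertLast n (o, π)) = j then
      qv ^ c (insertLast n (o, π)) * xv ^ cyc (insertLast n (o, π)) else 0)
    = xv * (if fix π + 1 = j then qv ^ c π * xv ^ cyc π else 0)
      + (j + 1) * (if fix π = j + 1 then qv ^ c π * xv ^ cyc π else 0)
      + euler b (if fix π = j then qv ^ c π * xv ^ cyc π else 0)
      + (n * qv + ((b - 1) * qv - b) * j) * (if fix π = j then qv ^ c π * xv ^ cyc π else 0) := by
  have hterm : ∀ i : Fin n, (if fix (insertLast n (some i, π)) = j then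
      qv ^ c (insertLast n (some i, π)) * xv ^ cyc (insertLast n (some i, π)) else 0)
      = (if π i = i then 1 else 0) * (if fix π = j + 1 then qv ^ c π * xv ^ cyc π else 0)
        + (((if π i ≠ i ∧ c (insertLast n (some i, π)) = c π then 1 else 0 : ℕ) : Coeff) * (1 - qv)
          + (1 - (if π i = i then 1 else 0)) * qv)
          * (if fix π = j then qv ^ c π * xv ^ cyc π else 0) := by
    intro i
    have hf := fix_insertLast_some π i
    rw [cyc_insertLast_some]
    by_cases h : π i = i
    · rw [if_pos h] at hf
      have : fix (insertLast n (some i, π)) = j ↔ fix π = j + 1 := by omega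
      simp [h, this, hc.fixed π i h]
    · rw [if_neg h, add_zero] at hf
      rw [hf]
      rcases hc.moved π i h with h1 | h1
      · simp [h, h1]
      · simp only [h, h1]
        by_cases hj : fix π = j
        · simp [hj, pow_succ]; ring
        · simp [hj]
  have hfix : (∑ i, if π i = i then (1 : Coeff) else 0) = (fix π : Coeff) := by
    rw [fix_eq_sum]; push_cast; rfl
  have hcount := congrArg (Nat.cast : ℕ → Coeff) (hc.count π)
  push_cast at hcount
  rw [Fintype.sum_option, Finset.sum_congr rfl fun i _ => hterm i, Finset.sum_add_distrib,
    ← Finset.sum_mul, ← Finset.sum_mul, Finset.sum_add_distrib, ← Finset.sum_mul, ← Finset.sum_mul,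
    Finset.sum_sub_distrib, hfix, fix_insertLast_none, cyc_insertLast_none, hc.none]
  rw [← Nat.cast_sum, Finset.sum_const, Finset.card_univ, Fintype.card_fin]
  push_cast
  set G : Coeff := ∑ i, if π i ≠ i ∧ c (insertLast n (some i, π)) = c π then 1 else 0
  have hG : G = 2 * c π + b * cyc π - b * fix π := by linear_combination hcount
  rw [hG]
  by_cases h1 : fix π = j
  · subst h1
    simp [euler_monomial]
    ring
  · by_cases h2 : fix π = j + 1
    · have h3 : ¬ (fix π + 1 = j) := by omega
      simp only [if_neg h1, if_neg h3, if_pos h2]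
      simp [euler, h2]
    · by_cases h3 : fix π + 1 = j
      · simp [h1, h2, h3, euler, pow_succ]; ring
      · simp [h1, h2, h3, euler]

theorem IsInsertionStat.fixSum_succ (hc : IsInsertionStat b c) (n j : ℕ) :
    fixSum c (n + 1) j = xv * fixSumPred c n j + (j + 1) * fixSum c n (j + 1)
      + euler b (fixSum c n j) + (n * qv + ((b - 1) * qv - b) * j) * fixSum c n j := by
  rw [fixSum, ← Equiv.sum_comp (insertLast n), Fintype.sum_prod_type_right,
    Finset.sum_congr rfl fun π _ => hc.sum_insertLast π j]
  simp only [Finset.sum_add_distrib, ← Finset.mul_sum, ← euler_sum]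
  rfl

theorem cyc_zero (π : Equiv.Perm (Fin 0)) : cyc π = 0 := by simp [cyc_eq_sum]

theorem fix_zero (π : Equiv.Perm (Fin 0)) : fix π = 0 := by simp [fix_eq_sum]

theorem IsInsertionStat.fixSum_zero (hc : IsInsertionStat b c) (j : ℕ) :
    fixSum c 0 j = if j = 0 then 1 else 0 := by
  simp [fixSum, cyc_zero, fix_zero, hc.zero, eq_comm]

/-- Removing a fixed point. -/
theorem IsInsertionStat.natCast_mul_fixSum (hc : IsInsertionStat b c) (n j : ℕ) :
    (j : Coeff) * fixSum c (n + 1) j = (n + 1) * xv * fixSumPred c n j := by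
  induction n generalizing j with
  | zero =>
    rcases j with _ | _ | j <;>
      simp [hc.fixSum_succ, hc.fixSum_zero, fixSumPred_zero, fixSumPred_succ, euler]
  | succ m ih =>
    rcases j with _ | j
    · simp [fixSumPred_zero]
    have h1 := ih (j + 2)
    have h2 := ih (j + 1)
    have h3 := ih j
    have h4 := hc.fixSum_succ m j
    -- The inductive identity is pushed through `euler b`; the extra term is the derivative of the
    -- factor `x`.
    have h5 : ((j + 1 : ℕ) : Coeff) * euler b (fixSum c (m + 1) (j + 1)) =
        (m + 1) * (xv * euler b (fixSum c m j) + b * (1 - qv) * xv * fixSum c m j) := by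
      rw [← euler_natCast_mul, h2, fixSumPred_succ, ← euler_xv_mul, ← Nat.cast_succ,
        ← euler_natCast_mul, mul_assoc]
    rw [hc.fixSum_succ (m + 1) (j + 1)]
    simp only [fixSumPred_succ] at h1 h2 ⊢
    push_cast at h1 h2 h3 h4 h5 ⊢
    linear_combination (j + 1 : Coeff) * h1 + h5 + xv * h3
      + ((m + 1) * qv + ((b - 1) * qv - b) * (j + 1)) * h2 - (m + 1) * xv * h4

end

/-! ### The differential operator on power series, and uniqueness. -/

/-- `(1 - q z) ∂F/∂z + 2 q (q - 1) ∂F/∂q + b x (q - 1) ∂F/∂x`. -/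
noncomputable def pdeOp (b : ℕ) (F : PowerSeries Coeff) : PowerSeries Coeff :=
  (1 - PowerSeries.C qv * PowerSeries.X) * dz F
    + PowerSeries.C (2 * qv * (qv - 1)) * dq F
    + PowerSeries.C (b * xv * (qv - 1)) * dx F

theorem peakPDE_iff (F : PowerSeries Coeff) :
    PeakPDE F ↔ pdeOp 1 F = PowerSeries.C xv * PowerSeries.X * F := by
  simp [PeakPDE, pdeOp]

theorem valleyPDE_iff (F : PowerSeries Coeff) :
    ValleyPDE F ↔ pdeOp 2 F = PowerSeries.C xv * PowerSeries.X * F := by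
  simp [ValleyPDE, pdeOp]

theorem coeff_pdeOp (b : ℕ) (F : PowerSeries Coeff) (n : ℕ) :
    PowerSeries.coeff n (pdeOp b F) = (n + 1) * PowerSeries.coeff (n + 1) F
      - n * qv * PowerSeries.coeff n F - euler b (PowerSeries.coeff n F) := by
  have h : PowerSeries.coeff n (PowerSeries.X * dz F) = n * PowerSeries.coeff n F := by
    rcases n with _ | n
    · simp
    · simp [dz, PowerSeries.coeff_succ_X_mul, PowerSeries.coeff_derivative, mul_comm]
  rw [pdeOp, sub_mul, one_mul, mul_assoc]
  simp only [map_add, map_sub, PowerSeries.coeff_C_mul, h]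
  simp only [dz, dq, dx, PowerSeries.coeff_mk,
    PowerSeries.coeff_derivative, euler]
  ring

/-- An equation `pdeOp b F = (u + v z) F` determines `F` from its constant term. -/
theorem eq_of_pdeOp_eq {b : ℕ} {u v : Coeff} {F G : PowerSeries Coeff}
    (hF : pdeOp b F = (PowerSeries.C u + PowerSeries.C v * PowerSeries.X) * F)
    (hG : pdeOp b G = (PowerSeries.C u + PowerSeries.C v * PowerSeries.X) * G)
    (h0 : PowerSeries.coeff 0 F = PowerSeries.coeff 0 G) : F = G := by
  ext1 n
  induction n using Nat.strong_induction_on with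
  | _ n ih =>
    rcases n with _ | n
    · exact h0
    have h1 := congrArg (PowerSeries.coeff n) hF
    have h2 := congrArg (PowerSeries.coeff n) hG
    have e : PowerSeries.coeff n ((PowerSeries.C u + PowerSeries.C v * PowerSeries.X) * F)
        = PowerSeries.coeff n ((PowerSeries.C u + PowerSeries.C v * PowerSeries.X) * G) := by
      rcases n with _ | n
      · simpa using Or.inl h0
      · simp only [add_mul, mul_assoc, map_add, PowerSeries.coeff_C_mul,
          PowerSeries.coeff_succ_X_mul]
        rw [ih n (by omega), ih (n + 1) (by omega)]
    rw [coeff_pdeOp] at h1 h2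
    rw [ih n (by omega)] at h1
    have hn : (n + 1 : Coeff) ≠ 0 := by exact_mod_cast Nat.succ_ne_zero n
    refine mul_left_cancel₀ hn ?_
    linear_combination h1 - h2 + e

/-- The exponential generating function of a statistic over the derangements. -/
noncomputable def derangementEGF (c : ∀ {n : ℕ}, Equiv.Perm (Fin n) → ℕ) : PowerSeries Coeff :=
  PowerSeries.mk fun n => (1 / (n.factorial : ℚ)) • fixSum c n 0

theorem peakEGF_eq : peakEGF = derangementEGF @cpk := by
  simp [peakEGF, derangementEGF, P, fixSum, zero_pow_eq]

theorem valleyEGF_eq : valleyEGF = derangementEGF @cval := by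
  simp [valleyEGF, derangementEGF, V, fixSum, zero_pow_eq]

theorem IsInsertionStat.coeff_zero_derangementEGF {b : ℕ}
    {c : ∀ {n : ℕ}, Equiv.Perm (Fin n) → ℕ} (hc : IsInsertionStat b c) :
    PowerSeries.coeff 0 (derangementEGF c) = 1 := by
  simp [derangementEGF, hc.fixSum_zero]

theorem natCast_succ_mul_factorial_smul (n : ℕ) (f : Coeff) :
    (n + 1 : Coeff) * ((1 / ((n + 1).factorial : ℚ)) • f) = (1 / (n.factorial : ℚ)) • f := by
  have : (n + 1 : Coeff) = MvPolynomial.C (n + 1 : ℚ) := by simp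
  rw [this, ← MvPolynomial.smul_eq_C_mul, smul_smul, Nat.factorial_succ]
  congr 1
  push_cast
  field_simp

theorem IsInsertionStat.pdeOp_derangementEGF {b : ℕ}
    {c : ∀ {n : ℕ}, Equiv.Perm (Fin n) → ℕ} (hc : IsInsertionStat b c) :
    pdeOp b (derangementEGF c) = PowerSeries.C xv * PowerSeries.X * derangementEGF c := by
  have hfac := natCast_succ_mul_factorial_smul
  ext1 n
  rw [coeff_pdeOp]
  simp only [derangementEGF, PowerSeries.coeff_mk]
  rw [hfac, hc.fixSum_succ, euler_qsmul, fixSumPred_zero]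
  rcases n with _ | n
  · have : fixSum c 0 1 = 0 := by simp [hc.fixSum_zero]
    simp [this]
  · have h := hc.natCast_mul_fixSum n 1
    rw [fixSumPred_succ] at h
    -- A permutation with one fixed point is a choice of that point and a derangement of the other
    -- `n` letters; this is the source of the term `x z F`.
    have h' : fixSum c (n + 1) 1 = (n + 1) * (xv * fixSum c n 0) := by
      push_cast at h; linear_combination h
    rw [mul_assoc (PowerSeries.C xv), PowerSeries.coeff_C_mul, PowerSeries.coeff_succ_X_mul,
      PowerSeries.coeff_mk]
    have h2 := hfac n (xv * fixSum c n 0)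
    simp only [h', MvPolynomial.smul_eq_C_mul] at h2 ⊢
    push_cast
    linear_combination h2

theorem IsInsertionStat.eq_derangementEGF {b : ℕ}
    {c : ∀ {n : ℕ}, Equiv.Perm (Fin n) → ℕ} (hc : IsInsertionStat b c) {F : PowerSeries Coeff}
    (hF : pdeOp b F = PowerSeries.C xv * PowerSeries.X * F) (h0 : F.constantCoeff = 1) :
    F = derangementEGF c := by
  refine eq_of_pdeOp_eq (b := b) (u := 0) (v := xv) (by simpa using hF)
    (by simpa using hc.pdeOp_derangementEGF) ?_
  rw [hc.coeff_zero_derangementEGF, PowerSeries.coeff_zero_eq_constantCoeff_apply, h0]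

theorem dq_mul (F G : PowerSeries Coeff) : dq (F * G) = F * dq G + G * dq F := by
  ext1 n
  rw [mul_comm G]
  simp only [dq, map_add, PowerSeries.coeff_mk, PowerSeries.coeff_mul, map_sum,
    Derivation.leibniz, smul_eq_mul, Finset.sum_add_distrib]
  simp only [mul_comm]

theorem dx_mul (F G : PowerSeries Coeff) : dx (F * G) = F * dx G + G * dx F := by
  ext1 n
  rw [mul_comm G]
  simp only [dx, map_add, PowerSeries.coeff_mk, PowerSeries.coeff_mul, map_sum,
    Derivation.leibniz, smul_eq_mul, Finset.sum_add_distrib]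
  simp only [mul_comm]

theorem dz_mul (F G : PowerSeries Coeff) : dz (F * G) = F * dz G + G * dz F := by
  simp [dz]

theorem pdeOp_mul (b : ℕ) (F G : PowerSeries Coeff) :
    pdeOp b (F * G) = F * pdeOp b G + G * pdeOp b F := by
  simp only [pdeOp, dq_mul, dx_mul, dz_mul]
  ring

theorem pdeOp_add (b : ℕ) (F G : PowerSeries Coeff) :
    pdeOp b (F + G) = pdeOp b F + pdeOp b G := by
  ext1 n
  simp only [coeff_pdeOp, map_add, euler]
  ring

theorem pdeOp_C (b : ℕ) (a : Coeff) : pdeOp b (PowerSeries.C a) = -PowerSeries.C (euler b a) := by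
  ext1 n
  rw [coeff_pdeOp]
  rw [← map_neg, PowerSeries.coeff_C, PowerSeries.coeff_C, PowerSeries.coeff_C]
  rcases n with _ | n <;> simp [euler]

theorem dz_dq (F : PowerSeries Coeff) : dz (dq F) = dq (dz F) := by
  ext1 n
  simp [dz, dq, PowerSeries.coeff_derivative, mul_comm]

theorem dz_dx (F : PowerSeries Coeff) : dz (dx F) = dx (dz F) := by
  ext1 n
  simp [dz, dx, PowerSeries.coeff_derivative, mul_comm]

/-- Among the coefficients of the operator only `1 - q z` depends on `z`, and its derivative is
`-q`. -/
theorem pdeOp_dz (b : ℕ) (F : PowerSeries Coeff) :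
    pdeOp b (dz F) = dz (pdeOp b F) + PowerSeries.C qv * dz F := by
  have h : dz (pdeOp b F) = (1 - PowerSeries.C qv * PowerSeries.X) * dz (dz F)
      - PowerSeries.C qv * dz F + PowerSeries.C (2 * qv * (qv - 1)) * dz (dq F)
      + PowerSeries.C (b * xv * (qv - 1)) * dz (dx F) := by
    simp only [pdeOp, dz, map_add, map_sub, Derivation.leibniz, PowerSeries.derivative_C,
      PowerSeries.derivative_X, smul_eq_mul, Derivation.map_one_eq_zero]
    ring
  rw [h, dz_dq, dz_dx, pdeOp]
  ring

/-! ### Reduction to an ordinary differential equation in `z`. -/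

/-- `n!` times the coefficients of `cos (r z) - sin (r z) / r`, where `t = - r ^ 2`. -/
def trigCoeff {R : Type*} [CommRing R] (t : R) : ℕ → R
  | 0 => 1
  | 1 => -1
  | n + 2 => t * trigCoeff t n

theorem map_trigCoeff {R S : Type*} [CommRing R] [CommRing S] (φ : R →+* S) (t : R) (n : ℕ) :
    φ (trigCoeff t n) = trigCoeff (φ t) n := by
  induction n using Nat.twoStepInduction with
  | zero => simp [trigCoeff]
  | one => simp [trigCoeff]
  | more n h _ => simp [trigCoeff, h]

/-- `cos (z √(q - 1)) - sin (z √(q - 1)) / √(q - 1)` as a power series in `z`. -/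
noncomputable def trigSeries : PowerSeries Coeff :=
  PowerSeries.mk fun n => (1 / (n.factorial : ℚ)) • trigCoeff (1 - qv) n

theorem trigCoeff_succ (b n : ℕ) : trigCoeff (1 - qv) (n + 1) =
    n * qv * trigCoeff (1 - qv) n + euler b (trigCoeff (1 - qv) n) - trigCoeff (1 - qv) n := by
  induction n using Nat.twoStepInduction with
  | zero => simp [trigCoeff, euler]
  | one => simp [trigCoeff, euler]; ring
  | more n h _ =>
    -- Passing from `n` to `n + 2` adds `2 q`, which cancels against the derivative of the new
    -- factor `1 - q`. No coefficient involves `x`, so `b` plays no role.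
    have e : ∀ f : Coeff, euler b ((1 - qv) * f) =
        (1 - qv) * euler b f - 2 * qv * (1 - qv) * f := by
      intro f
      simp only [euler, Derivation.leibniz, smul_eq_mul, map_sub, Derivation.map_one_eq_zero,
        MvPolynomial.pderiv_X_self, MvPolynomial.pderiv_X_of_ne (show (0 : Fin 2) ≠ 1 by decide)]
      ring
    rw [trigCoeff, trigCoeff, e, h]
    push_cast
    ring

theorem pdeOp_trigSeries (b : ℕ) : pdeOp b trigSeries = -trigSeries := by
  ext1 n
  rw [coeff_pdeOp, map_neg]
  simp only [trigSeries, PowerSeries.coeff_mk]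
  rw [natCast_succ_mul_factorial_smul, trigCoeff_succ b, euler_qsmul]
  simp only [MvPolynomial.smul_eq_C_mul]
  ring

theorem coeff_zero_trigSeries : PowerSeries.constantCoeff trigSeries = 1 := by
  rw [← PowerSeries.coeff_zero_eq_constantCoeff_apply]
  simp [trigSeries, trigCoeff]

theorem constantCoeff_dz_trigSeries : PowerSeries.constantCoeff (dz trigSeries) = -1 := by
  rw [← PowerSeries.coeff_zero_eq_constantCoeff_apply]
  simp [dz, PowerSeries.coeff_derivative, trigSeries, trigCoeff]

theorem constantCoeff_dz_eq_zero {b : ℕ} {F : PowerSeries Coeff}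
    (hF : pdeOp b F = PowerSeries.C xv * PowerSeries.X * F) (h0 : F.constantCoeff = 1) :
    PowerSeries.constantCoeff (dz F) = 0 := by
  have h := congrArg (PowerSeries.coeff 0) hF
  rw [coeff_pdeOp] at h
  rw [← PowerSeries.coeff_zero_eq_constantCoeff_apply, dz, PowerSeries.coeff_derivative]
  simpa [h0, euler] using h

theorem pdeOp_dz_of_eq {b : ℕ} {F : PowerSeries Coeff}
    (hF : pdeOp b F = PowerSeries.C xv * PowerSeries.X * F) :
    pdeOp b (dz F) = PowerSeries.C xv * F + PowerSeries.C xv * PowerSeries.X * dz F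
      + PowerSeries.C qv * dz F := by
  rw [pdeOp_dz, hF]
  simp only [dz, Derivation.leibniz, PowerSeries.derivative_C, PowerSeries.derivative_X,
    smul_eq_mul]
  ring

theorem eq_zero_of_pdeOp_eq {b : ℕ} {u v : Coeff} {F : PowerSeries Coeff}
    (hF : pdeOp b F = (PowerSeries.C u + PowerSeries.C v * PowerSeries.X) * F)
    (h0 : F.constantCoeff = 0) : F = 0 := by
  refine eq_of_pdeOp_eq hF ?_ (by simpa using h0)
  ext1 n
  rw [coeff_pdeOp]
  simp [euler]

/-- The peak equation gives a linear differential equation in `z` alone. -/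
theorem ode_of_pdeOp_one {F : PowerSeries Coeff}
    (hF : pdeOp 1 F = PowerSeries.C xv * PowerSeries.X * F) (h0 : F.constantCoeff = 1) :
    trigSeries * dz F = PowerSeries.C xv * (1 - trigSeries) * F := by
  rw [← sub_eq_zero]
  have hx : pdeOp 1 (PowerSeries.C xv) = PowerSeries.C (xv * (qv - 1)) := by
    rw [pdeOp_C, ← map_neg]; congr 1
    simp [euler]; ring
  have e : trigSeries * dz F - PowerSeries.C xv * (1 - trigSeries) * F =
      trigSeries * dz F + (PowerSeries.C xv * (trigSeries * F) + PowerSeries.C (-1)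
        * (PowerSeries.C xv * F)) := by
    simp; ring
  have h1 : pdeOp 1 (PowerSeries.C (-1)) = 0 := by rw [pdeOp_C]; simp [euler]
  -- The defect is multiplied by `q - 1 + x z`: in `w F'`, the factor `w` gives `-1` and the
  -- commutator with `∂/∂z` gives `q`.
  refine eq_zero_of_pdeOp_eq (b := 1) (u := qv - 1) (v := xv) ?_ ?_
  · rw [e]
    simp only [pdeOp_add, pdeOp_mul, hx, h1, hF, pdeOp_dz_of_eq hF, pdeOp_trigSeries]
    simp only [map_mul, map_sub, map_neg, map_one]
    ring
  · simp [coeff_zero_trigSeries, constantCoeff_dz_eq_zero hF h0]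

/-- The valley equation gives a linear differential equation in `z` alone. -/
theorem ode_of_pdeOp_two {F : PowerSeries Coeff}
    (hF : pdeOp 2 F = PowerSeries.C xv * PowerSeries.X * F) (h0 : F.constantCoeff = 1) :
    PowerSeries.C qv * trigSeries * dz F
      = -(PowerSeries.C xv * (trigSeries + dz trigSeries)) * F := by
  rw [← sub_eq_zero, neg_mul, sub_neg_eq_add]
  have hx : pdeOp 2 (PowerSeries.C xv) = PowerSeries.C (2 * xv * (qv - 1)) := by
    rw [pdeOp_C, ← map_neg]; congr 1
    simp [euler]; ring
  have hq : pdeOp 2 (PowerSeries.C qv) = PowerSeries.C (2 * qv * (qv - 1)) := by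
    rw [pdeOp_C, ← map_neg]; congr 1
    simp [euler]; ring
  have hw : pdeOp 2 (dz trigSeries) = PowerSeries.C (qv - 1) * dz trigSeries := by
    rw [pdeOp_dz, pdeOp_trigSeries]
    simp only [dz, map_neg, map_sub, map_one]
    ring
  -- Here the prefactor `q` contributes a further `2 (q - 1)`, whence `3 (q - 1)`.
  refine eq_zero_of_pdeOp_eq (b := 2) (u := 3 * (qv - 1)) (v := xv) ?_ ?_
  · simp only [pdeOp_add, pdeOp_mul, hx, hq, hw, hF, pdeOp_dz_of_eq hF, pdeOp_trigSeries]
    simp only [map_mul, map_sub, map_one, map_ofNat]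
    ring
  · simp [coeff_zero_trigSeries, constantCoeff_dz_trigSeries, constantCoeff_dz_eq_zero hF h0]

/-! ### Complex Taylor series. -/

/-- A linear first order differential equation determines a power series from its constant
term. -/
theorem powerSeries_ode_unique {A B F G : PowerSeries ℂ} (hA : A.constantCoeff ≠ 0)
    (hF : A * PowerSeries.derivative ℂ F = B * F) (hG : A * PowerSeries.derivative ℂ G = B * G)
    (h0 : F.constantCoeff = G.constantCoeff) : F = G := by
  have hF' : PowerSeries.derivative ℂ F = A⁻¹ * B * F := by
    rw [mul_assoc, ← hF, ← mul_assoc, PowerSeries.inv_mul_cancel _ hA, one_mul]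
  have hG' : PowerSeries.derivative ℂ G = A⁻¹ * B * G := by
    rw [mul_assoc, ← hG, ← mul_assoc, PowerSeries.inv_mul_cancel _ hA, one_mul]
  ext1 n
  induction n using Nat.strong_induction_on with
  | _ n ih =>
    rcases n with _ | n
    · simpa using h0
    have h1 := congrArg (PowerSeries.coeff n) hF'
    have h2 := congrArg (PowerSeries.coeff n) hG'
    rw [PowerSeries.coeff_derivative, PowerSeries.coeff_mul] at h1 h2
    have hn : (n + 1 : ℂ) ≠ 0 := by exact_mod_cast Nat.succ_ne_zero n
    refine mul_right_cancel₀ hn ?_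
    rw [h1, h2]
    refine Finset.sum_congr rfl fun p hp => ?_
    rw [ih p.2 (by have := Finset.HasAntidiagonal.mem_antidiagonal.1 hp; omega)]

/-- The Taylor series at `0`. -/
noncomputable def taylor (f : ℂ → ℂ) : PowerSeries ℂ :=
  PowerSeries.mk fun n => iteratedDeriv n f 0 / n.factorial

theorem taylor_congr {f g : ℂ → ℂ} (h : f =ᶠ[𝓝 0] g) : taylor f = taylor g := by
  ext n
  simp [taylor, (h.iteratedDeriv n).eq_of_nhds]

theorem taylor_mul {f g : ℂ → ℂ} (hf : AnalyticAt ℂ f 0) (hg : AnalyticAt ℂ g 0) :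
    taylor (fun z => f z * g z) = taylor f * taylor g := by
  ext n
  have h := iteratedDeriv_mul (n := n) hf.contDiffAt hg.contDiffAt
  simp only [taylor, PowerSeries.coeff_mk, PowerSeries.coeff_mul]
  change iteratedDeriv n (f * g) 0 / _ = _
  rw [h, Finset.sum_div, Finset.Nat.sum_antidiagonal_eq_sum_range_succ_mk]
  refine Finset.sum_congr rfl fun i hi => ?_
  rw [Nat.cast_choose _ (by grind)]
  field_simp [Nat.factorial_ne_zero]

theorem taylor_deriv (f : ℂ → ℂ) : taylor (deriv f) = PowerSeries.derivative ℂ (taylor f) := by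
  ext n
  rw [PowerSeries.coeff_derivative]
  simp only [taylor, PowerSeries.coeff_mk]
  rw [← iteratedDeriv_succ', Nat.factorial_succ]
  have : (n.factorial : ℂ) ≠ 0 := by exact_mod_cast n.factorial_ne_zero
  have hn : (n + 1 : ℂ) ≠ 0 := by exact_mod_cast Nat.succ_ne_zero n
  push_cast
  field_simp

theorem constantCoeff_taylor (f : ℂ → ℂ) : (taylor f).constantCoeff = f 0 := by
  rw [← PowerSeries.coeff_zero_eq_constantCoeff_apply]
  simp [taylor]

theorem taylor_add {f g : ℂ → ℂ} (hf : AnalyticAt ℂ f 0) (hg : AnalyticAt ℂ g 0) :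
    taylor (fun z => f z + g z) = taylor f + taylor g := by
  ext n
  have h := iteratedDeriv_add (n := n) hf.contDiffAt hg.contDiffAt
  simp only [taylor, PowerSeries.coeff_mk, map_add]
  change iteratedDeriv n (f + g) 0 / _ = _
  rw [h, add_div]

theorem taylor_const (a : ℂ) : taylor (fun _ => a) = PowerSeries.C a := by
  ext n
  rcases n with _ | n <;> simp [taylor, iteratedDeriv_const, PowerSeries.coeff_C]

theorem hasSum_taylor {f : ℂ → ℂ} (hf : AnalyticAt ℂ f 0) :
    ∀ᶠ z : ℂ in 𝓝 0, HasSum (fun n : ℕ => PowerSeries.coeff n (taylor f) * z ^ n) (f z) := by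
  obtain ⟨r, hr, h⟩ := Metric.eventually_nhds_iff_ball.1 hf.eventually_analyticAt
  have hd : DifferentiableOn ℂ f (Metric.ball 0 r) := fun z hz =>
    (h z hz).differentiableAt.differentiableWithinAt
  filter_upwards [Metric.ball_mem_nhds (0 : ℂ) hr] with z hz
  refine (Complex.hasSum_taylorSeries_on_ball hd hz).congr_fun ?_
  intro n
  simp [taylor]
  ring

/-! ### The closed forms as solutions of the ordinary equations. -/

/-- `cos (z r) - sin (z r) / r`. -/
noncomputable def trig (r z : ℂ) : ℂ := Complex.cos (z * r) - Complex.sin (z * r) / r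

theorem hasDerivAt_cos_mul (r z : ℂ) :
    HasDerivAt (fun z => Complex.cos (z * r)) (-Complex.sin (z * r) * r) z := by
  simpa using (hasDerivAt_mul_const r (x := z)).ccos

theorem hasDerivAt_sin_mul (r z : ℂ) :
    HasDerivAt (fun z => Complex.sin (z * r)) (Complex.cos (z * r) * r) z := by
  simpa using (hasDerivAt_mul_const r (x := z)).csin

theorem hasDerivAt_trig {r : ℂ} (hr : r ≠ 0) (z : ℂ) :
    HasDerivAt (trig r) (-Complex.sin (z * r) * r - Complex.cos (z * r)) z := by
  have := (hasDerivAt_cos_mul r z).sub ((hasDerivAt_sin_mul r z).div_const r)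
  rw [mul_div_cancel_right₀ _ hr] at this
  exact this

theorem deriv_deriv_trig {r : ℂ} (hr : r ≠ 0) :
    deriv (deriv (trig r)) = fun z => -r ^ 2 * trig r z := by
  have h1 : deriv (trig r) = fun z => -Complex.sin (z * r) * r - Complex.cos (z * r) :=
    funext fun z => (hasDerivAt_trig hr z).deriv
  funext z
  rw [h1]
  have := ((hasDerivAt_sin_mul r z).neg.mul_const r).sub (hasDerivAt_cos_mul r z)
  refine (HasDerivAt.deriv this).trans ?_
  rw [trig]
  field_simp
  ring

theorem iteratedDeriv_trig {r : ℂ} (hr : r ≠ 0) (n : ℕ) :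
    iteratedDeriv n (trig r) 0 = trigCoeff (-r ^ 2) n := by
  induction n using Nat.twoStepInduction with
  | zero => simp [trigCoeff, trig]
  | one => simp [trigCoeff, (hasDerivAt_trig hr 0).deriv]
  | more n h _ =>
    rw [iteratedDeriv_succ', iteratedDeriv_succ', deriv_deriv_trig hr,
      iteratedDeriv_const_mul_field, h, trigCoeff]

/-- Evaluation of `ℚ[q, x]` at complex numbers. -/
noncomputable def evalAt (q x : ℂ) : Coeff →ₐ[ℚ] ℂ := MvPolynomial.aeval ![q, x]

/-- Evaluation of the coefficients of a power series. -/
noncomputable def evalSeries (q x : ℂ) : PowerSeries Coeff →+* PowerSeries ℂ :=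
  PowerSeries.map (evalAt q x : Coeff →+* ℂ)

theorem evalAt_qv (q x : ℂ) : evalAt q x qv = q := by simp [evalAt]

theorem evalAt_xv (q x : ℂ) : evalAt q x xv = x := by simp [evalAt]

theorem evalSeries_dz (q x : ℂ) (F : PowerSeries Coeff) :
    evalSeries q x (dz F) = PowerSeries.derivative ℂ (evalSeries q x F) := by
  ext n
  simp [evalSeries, dz, PowerSeries.coeff_derivative]

theorem evalSeries_C (q x : ℂ) (a : Coeff) :
    evalSeries q x (PowerSeries.C a) = PowerSeries.C (evalAt q x a) := by
  simp [evalSeries]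

theorem evalSeries_trigSeries {q x r : ℂ} (hr : r ≠ 0) (hq : r ^ 2 = q - 1) :
    evalSeries q x trigSeries = taylor (trig r) := by
  ext n
  have h : (1 - q) = -r ^ 2 := by rw [hq]; ring
  have h' := map_trigCoeff (evalAt q x : Coeff →+* ℂ) (1 - qv) n
  simp only [RingHom.coe_coe, map_sub, map_one, evalAt_qv, h] at h'
  simp only [evalSeries, trigSeries, taylor, PowerSeries.coeff_map, PowerSeries.coeff_mk,
    iteratedDeriv_trig hr, RingHom.coe_coe, map_smul, h']
  rw [Rat.smul_def]
  push_cast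
  ring

theorem analyticAt_trig (r z : ℂ) : AnalyticAt ℂ (trig r) z := by
  unfold trig
  fun_prop

/-- Functions of the form `exp (a z) * g z ^ c` with `g 0 = 1`. -/
theorem exp_mul_cpow {g : ℂ → ℂ} (hg : AnalyticAt ℂ g 0) (h0 : g 0 = 1) (a c : ℂ) :
    AnalyticAt ℂ (fun z => Complex.exp (a * z) * g z ^ c) 0 ∧
      ∀ᶠ z in 𝓝 0, g z ≠ 0 ∧ g z * deriv (fun z => Complex.exp (a * z) * g z ^ c) z
        = (a * g z + c * deriv g z) * (Complex.exp (a * z) * g z ^ c) := by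
  have hs : g 0 ∈ Complex.slitPlane := by rw [h0]; exact Complex.one_mem_slitPlane
  constructor
  · exact AnalyticAt.mul (by fun_prop) (hg.cpow analyticAt_const hs)
  -- Near 0 the base is close to 1, hence in the slit plane, where the principal power is
  -- differentiable.
  · filter_upwards [hg.continuousAt.eventually (Complex.isOpen_slitPlane.mem_nhds hs),
      hg.eventually_analyticAt] with z hz ha
    have hz0 : g z ≠ 0 := Complex.slitPlane_ne_zero hz
    refine ⟨hz0, ?_⟩
    have h1 : HasDerivAt (fun z => Complex.exp (a * z)) (Complex.exp (a * z) * a) z := by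
      simpa using ((hasDerivAt_id z).const_mul a).cexp
    have h2 := ha.differentiableAt.hasDerivAt.cpow_const (c := c) hz
    have h3 := (h1.mul h2).deriv
    change deriv (fun z => Complex.exp (a * z) * g z ^ c) z = _ at h3
    rw [h3, Complex.cpow_sub _ _ hz0, Complex.cpow_one]
    field_simp

theorem sq_sub_sq_trig {r s : ℂ} (hr : r ≠ 0) (hs : s ^ 2 = r ^ 2 + 1) (z : ℂ) :
    (s + Complex.cos (z * r) + r * Complex.sin (z * r))
      * (s - Complex.cos (z * r) - r * Complex.sin (z * r)) = r ^ 2 * trig r z ^ 2 := by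
  have h := Complex.sin_sq_add_cos_sq (z * r)
  have h1 : r * trig r z = r * Complex.cos (z * r) - Complex.sin (z * r) := by
    rw [trig]; field_simp
  rw [← mul_pow, h1]
  linear_combination hs - (r ^ 2 + 1) * h

/-- The base of the power in the closed form of the peak generating function. -/
noncomputable def peakBase (r s z : ℂ) : ℂ :=
  ((s - 1) / (s + 1)) *
    ((s + Complex.cos (z * r) + r * Complex.sin (z * r)) /
      (s - Complex.cos (z * r) - r * Complex.sin (z * r)))

section

variable {r s : ℂ}

theorem sub_one_ne_zero_of_sq (hr : r ≠ 0) (hs : s ^ 2 = r ^ 2 + 1) : s - 1 ≠ 0 := by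
  intro h
  refine pow_ne_zero 2 hr ?_
  linear_combination (s + 1) * h - hs

theorem add_one_ne_zero_of_sq (hr : r ≠ 0) (hs : s ^ 2 = r ^ 2 + 1) : s + 1 ≠ 0 := by
  intro h
  refine pow_ne_zero 2 hr ?_
  linear_combination (s - 1) * h - hs

theorem peakBase_zero (hr : r ≠ 0) (hs : s ^ 2 = r ^ 2 + 1) : peakBase r s 0 = 1 := by
  have := sub_one_ne_zero_of_sq hr hs
  have := add_one_ne_zero_of_sq hr hs
  simp [peakBase]
  field_simp

theorem analyticAt_peakBase (hr : r ≠ 0) (hs : s ^ 2 = r ^ 2 + 1) :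
    AnalyticAt ℂ (peakBase r s) 0 := by
  have := sub_one_ne_zero_of_sq hr hs
  unfold peakBase
  refine analyticAt_const.mul (AnalyticAt.div (by fun_prop) (by fun_prop) ?_)
  simpa using this

/-- With `u = cos (z r) + r sin (z r)` one has `u' = r ^ 2 w` and `s ^ 2 - u ^ 2 = r ^ 2 w ^ 2`, so
the logarithmic derivative of `(s + u) / (s - u)` is `2 s u' / (s ^ 2 - u ^ 2) = 2 s / w`. -/
theorem trig_mul_deriv_peakBase (hr : r ≠ 0) (hs : s ^ 2 = r ^ 2 + 1) :
    ∀ᶠ z in 𝓝 0, trig r z * deriv (peakBase r s) z = 2 * s * peakBase r s z := by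
  have h1 := sub_one_ne_zero_of_sq hr hs
  have hc : ContinuousAt (fun z => s - Complex.cos (z * r) - r * Complex.sin (z * r)) 0 := by
    fun_prop
  have hc0 : s - Complex.cos (0 * r) - r * Complex.sin (0 * r) ≠ 0 := by simpa using h1
  filter_upwards [hc.eventually_ne hc0] with z hz
  have hd := (((hasDerivAt_cos_mul r z).const_add s).add
    ((hasDerivAt_sin_mul r z).const_mul r)).div
    (((hasDerivAt_cos_mul r z).const_sub s).sub ((hasDerivAt_sin_mul r z).const_mul r)) hz
  have hd' := (hd.const_mul ((s - 1) / (s + 1))).deriv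
  change deriv (peakBase r s) z = _ at hd'
  rw [hd', peakBase]
  have hu : -Complex.sin (z * r) * r + r * (Complex.cos (z * r) * r) = r ^ 2 * trig r z := by
    rw [trig]; field_simp; ring
  have hu' : - (-Complex.sin (z * r) * r) - r * (Complex.cos (z * r) * r) =
      -(r ^ 2 * trig r z) := by
    rw [← hu]; ring
  have key := sq_sub_sq_trig hr hs z
  simp only [Pi.add_apply, Pi.sub_apply]
  rw [hu, hu']
  rw [mul_left_comm, mul_left_comm (2 * s)]
  congr 1
  rw [← mul_div_assoc, ← mul_div_assoc, div_eq_div_iff (pow_ne_zero 2 hz) hz]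
  linear_combination
    (-2 * s * (s - Complex.cos (z * r) - r * Complex.sin (z * r))) * key

end

theorem taylor_trig_ne_zero (r : ℂ) : (taylor (trig r)).constantCoeff ≠ 0 := by
  rw [constantCoeff_taylor]
  simp [trig]

theorem constantCoeff_evalSeries {F : PowerSeries Coeff} (h0 : F.constantCoeff = 1) (q x : ℂ) :
    (evalSeries q x F).constantCoeff = 1 := by
  rw [evalSeries, ← PowerSeries.coeff_zero_eq_constantCoeff_apply, PowerSeries.coeff_map,
    PowerSeries.coeff_zero_eq_constantCoeff_apply, h0, map_one]

/-- Both sides solve `w f' = x (1 - w) f`: the exponent `x / (2 s)` turns the logarithmic derivative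
`2 s / w` of the base into `x / w`, and the exponential contributes `-x`. -/
theorem evalSeries_eq_taylor_peak {F : PowerSeries Coeff}
    (hF : pdeOp 1 F = PowerSeries.C xv * PowerSeries.X * F) (h0 : F.constantCoeff = 1)
    {q x r s : ℂ} (hr0 : r ≠ 0) (hs0 : s ≠ 0) (hr : r ^ 2 = q - 1) (hs : s ^ 2 = r ^ 2 + 1) :
    evalSeries q x F
      = taylor (fun z => Complex.exp (-x * z) * peakBase r s z ^ (x / (2 * s))) := by
  obtain ⟨ha, hd⟩ := exp_mul_cpow (analyticAt_peakBase hr0 hs) (peakBase_zero hr0 hs)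
    (-x) (x / (2 * s))
  set f := fun z => Complex.exp (-x * z) * peakBase r s z ^ (x / (2 * s)) with hf
  have hw := analyticAt_trig r 0
  have hode : (fun z => trig r z * deriv f z)
      =ᶠ[𝓝 0] fun z => (x + (-x) * trig r z) * f z := by
    filter_upwards [hd, trig_mul_deriv_peakBase hr0 hs] with z ⟨hz0, hz⟩ hz'
    refine mul_left_cancel₀ hz0 ?_
    have e : x / (2 * s) * (2 * s) = x := by field_simp
    change _ * (_ * deriv f z) = _
    rw [mul_left_comm, hz]
    change _ * (_ * f z) = _
    linear_combination (x / (2 * s) * f z) * hz' + (peakBase r s z * f z) * e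
  refine powerSeries_ode_unique (A := taylor (trig r))
    (B := PowerSeries.C x * (1 - taylor (trig r))) (taylor_trig_ne_zero r) ?_ ?_ ?_
  · have h := congrArg (evalSeries q x) (ode_of_pdeOp_one hF h0)
    simpa only [map_mul, map_sub, map_one, evalSeries_dz, evalSeries_C, evalAt_xv,
      evalSeries_trigSeries hr0 hr] using h
  · have h := taylor_congr hode
    rw [taylor_mul hw ha.deriv, taylor_mul (by fun_prop) ha,
      taylor_add analyticAt_const (by fun_prop), taylor_mul analyticAt_const hw, taylor_const,
      taylor_const, taylor_deriv] at h
    rw [h, map_neg]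
    ring
  · rw [constantCoeff_evalSeries h0, constantCoeff_taylor]
    simp [hf, peakBase_zero hr0 hs]

theorem evalSeries_eq_taylor_valley {F : PowerSeries Coeff}
    (hF : pdeOp 2 F = PowerSeries.C xv * PowerSeries.X * F) (h0 : F.constantCoeff = 1)
    {q x r : ℂ} (hr0 : r ≠ 0) (hq0 : q ≠ 0) (hr : r ^ 2 = q - 1) :
    evalSeries q x F
      = taylor (fun z => Complex.exp (-(x / q) * z) * (trig r z)⁻¹ ^ (x / q)) := by
  have hw := analyticAt_trig r 0
  have hw0 : trig r 0 = 1 := by simp [trig]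
  have hwi : AnalyticAt ℂ (fun z => (trig r z)⁻¹) 0 := hw.inv (by simp [hw0])
  obtain ⟨ha, hd⟩ := exp_mul_cpow hwi (by simp [hw0]) (-(x / q)) (x / q)
  set f := fun z => Complex.exp (-(x / q) * z) * (trig r z)⁻¹ ^ (x / q) with hf
  have hode : (fun z => (q * trig r z) * deriv f z)
      =ᶠ[𝓝 0] fun z => ((-x) * (trig r z + deriv (trig r) z)) * f z := by
    filter_upwards [hd] with z ⟨hz0, hz⟩
    -- Since `0⁻¹ = 0`, a nonzero inverse forces a nonzero `trig r z`.
    have hz1 : trig r z ≠ 0 := fun h => hz0 (by simp [h])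
    have hi : deriv (fun z => (trig r z)⁻¹) z = -deriv (trig r) z / trig r z ^ 2 :=
      ((analyticAt_trig r z).differentiableAt.hasDerivAt.inv hz1).deriv
    rw [hi] at hz
    change _ * deriv f z = _ * f z at hz
    have hz2 : deriv f z = trig r z * ((-(x / q) * (trig r z)⁻¹
        + x / q * (-deriv (trig r) z / trig r z ^ 2)) * f z) := by
      rw [← hz, mul_inv_cancel_left₀ hz1]
    rw [hz2]
    field_simp
    ring
  refine powerSeries_ode_unique (A := PowerSeries.C q * taylor (trig r))
    (B := -(PowerSeries.C x * (taylor (trig r) + PowerSeries.derivative ℂ (taylor (trig r)))))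
    ?_ ?_ ?_ ?_
  · simpa [hq0] using taylor_trig_ne_zero r
  · have h := congrArg (evalSeries q x) (ode_of_pdeOp_two hF h0)
    simpa only [map_mul, map_add, map_neg, evalSeries_dz, evalSeries_C, evalAt_xv, evalAt_qv,
      evalSeries_trigSeries hr0 hr] using h
  · have h := taylor_congr hode
    have hwd : AnalyticAt ℂ (fun z => trig r z + deriv (trig r) z) 0 := hw.add hw.deriv
    rw [taylor_mul (by fun_prop) ha.deriv, taylor_mul (by fun_prop) ha,
      taylor_mul analyticAt_const hw, taylor_mul analyticAt_const hwd, taylor_add hw hw.deriv, taylor_const,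
      taylor_const, taylor_deriv, taylor_deriv] at h
    rw [h, map_neg]
    ring
  · rw [constantCoeff_evalSeries h0, constantCoeff_taylor]
    simp [hf, hw0]

/-! ### Specialisation to complex `q` and `x`. -/

theorem coeff_evalSeries_peakEGF (q x : ℂ) (n : ℕ) :
    PowerSeries.coeff n (evalSeries q x peakEGF) = P n q x 0 / n.factorial := by
  simp only [evalSeries, peakEGF, PowerSeries.coeff_map, PowerSeries.coeff_mk, P,
    RingHom.coe_coe, map_smul, map_sum, map_mul, map_pow, evalAt_qv, evalAt_xv, map_zero]
  rw [Rat.smul_def]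
  push_cast
  ring

theorem coeff_evalSeries_valleyEGF (q x : ℂ) (n : ℕ) :
    PowerSeries.coeff n (evalSeries q x valleyEGF) = V n q x 0 / n.factorial := by
  simp only [evalSeries, valleyEGF, PowerSeries.coeff_map, PowerSeries.coeff_mk, V,
    RingHom.coe_coe, map_smul, map_sum, map_mul, map_pow, evalAt_qv, evalAt_xv, map_zero]
  rw [Rat.smul_def]
  push_cast
  ring

theorem pdeOp_peakEGF : pdeOp 1 peakEGF = PowerSeries.C xv * PowerSeries.X * peakEGF := by
  rw [peakEGF_eq]; exact isInsertionStat_cpk.pdeOp_derangementEGF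

theorem pdeOp_valleyEGF : pdeOp 2 valleyEGF = PowerSeries.C xv * PowerSeries.X * valleyEGF := by
  rw [valleyEGF_eq]; exact isInsertionStat_cval.pdeOp_derangementEGF

theorem constantCoeff_peakEGF : peakEGF.constantCoeff = 1 := by
  rw [peakEGF_eq, ← PowerSeries.coeff_zero_eq_constantCoeff_apply]
  exact isInsertionStat_cpk.coeff_zero_derangementEGF

theorem constantCoeff_valleyEGF : valleyEGF.constantCoeff = 1 := by
  rw [valleyEGF_eq, ← PowerSeries.coeff_zero_eq_constantCoeff_apply]
  exact isInsertionStat_cval.coeff_zero_derangementEGF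

theorem hasSum_peak {q x r s : ℂ} (hq0 : q ≠ 0) (hq1 : q ≠ 1) (hs : s ^ 2 = q)
    (hr : r ^ 2 = q - 1) :
    ∀ᶠ z : ℂ in 𝓝 0, HasSum (fun n : ℕ => P n q x 0 * z ^ n / (n.factorial : ℂ))
      (Complex.exp (-(x * z)) * peakBase r s z ^ (x / (2 * s))) := by
  have hr0 : r ≠ 0 := by
    rintro rfl; exact hq1 (by linear_combination -hr)
  have hs0 : s ≠ 0 := by
    rintro rfl; exact hq0 (by linear_combination -hs)
  have hs' : s ^ 2 = r ^ 2 + 1 := by rw [hs, hr]; ring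
  have ha := (exp_mul_cpow (analyticAt_peakBase hr0 hs') (peakBase_zero hr0 hs')
    (-x) (x / (2 * s))).1
  filter_upwards [hasSum_taylor ha] with z hz
  rw [← evalSeries_eq_taylor_peak pdeOp_peakEGF constantCoeff_peakEGF hr0 hs0 hr hs'] at hz
  simpa only [coeff_evalSeries_peakEGF, div_mul_eq_mul_div, neg_mul] using hz

theorem hasSum_valley {q x r : ℂ} (hq0 : q ≠ 0) (hq1 : q ≠ 1) (hr : r ^ 2 = q - 1) :
    ∀ᶠ z : ℂ in 𝓝 0, HasSum (fun n : ℕ => V n q x 0 * z ^ n / (n.factorial : ℂ))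
      (Complex.exp (-(x * z) / q) *
        (r / (r * Complex.cos (z * r) - Complex.sin (z * r))) ^ (x / q)) := by
  have hr0 : r ≠ 0 := by
    rintro rfl; exact hq1 (by linear_combination -hr)
  have hwi : AnalyticAt ℂ (fun z => (trig r z)⁻¹) 0 :=
    (analyticAt_trig r 0).inv (by simp [trig])
  have ha := (exp_mul_cpow hwi (by simp [trig]) (-(x / q)) (x / q)).1
  filter_upwards [hasSum_taylor ha] with z hz
  rw [← evalSeries_eq_taylor_valley pdeOp_valleyEGF constantCoeff_valleyEGF hr0 hq0 hr] at hz
  have e1 : r / (r * Complex.cos (z * r) - Complex.sin (z * r)) = (trig r z)⁻¹ := by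
    rw [trig, ← one_div, ← mul_div_mul_left 1 _ hr0, mul_one, mul_sub, mul_div_cancel₀ _ hr0]
  have e2 : -(x * z) / q = -(x / q) * z := by ring
  rw [e1, e2]
  simpa only [coeff_evalSeries_valleyEGF, div_mul_eq_mul_div] using hz

end CyclicStat

theorem mainTheorem3 :
    -- the two partial differential equations, and uniqueness of the solutions
    (CyclicStat.PeakPDE CyclicStat.peakEGF ∧
      CyclicStat.peakEGF.constantCoeff = 1 ∧
      ∀ F : PowerSeries CyclicStat.Coeff, CyclicStat.PeakPDE F → F.constantCoeff = 1 →
        F = CyclicStat.peakEGF) ∧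
    (CyclicStat.ValleyPDE CyclicStat.valleyEGF ∧
      CyclicStat.valleyEGF.constantCoeff = 1 ∧
      ∀ F : PowerSeries CyclicStat.Coeff, CyclicStat.ValleyPDE F → F.constantCoeff = 1 →
        F = CyclicStat.valleyEGF) ∧
    -- the closed forms; `s` and `r` are arbitrary square roots of `q` and `q - 1`
    (∀ q x s r : ℂ, q ≠ 0 → q ≠ 1 → s ^ 2 = q → r ^ 2 = q - 1 →
      ∀ᶠ z : ℂ in 𝓝 0,
        HasSum (fun n : ℕ => CyclicStat.P n q x 0 * z ^ n / (n.factorial : ℂ))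
          (Complex.exp (-(x * z)) *
            (((s - 1) / (s + 1)) *
              ((s + Complex.cos (z * r) + r * Complex.sin (z * r)) /
                (s - Complex.cos (z * r) - r * Complex.sin (z * r)))) ^ (x / (2 * s)))) ∧
    (∀ q x r : ℂ, q ≠ 0 → q ≠ 1 → r ^ 2 = q - 1 →
      ∀ᶠ z : ℂ in 𝓝 0,
        HasSum (fun n : ℕ => CyclicStat.V n q x 0 * z ^ n / (n.factorial : ℂ))
          (Complex.exp (-(x * z) / q) *
            (r / (r * Complex.cos (z * r) - Complex.sin (z * r))) ^ (x / q))) := by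
  refine ⟨⟨?_, CyclicStat.constantCoeff_peakEGF, fun F hF h0 => ?_⟩,
    ⟨?_, CyclicStat.constantCoeff_valleyEGF, fun F hF h0 => ?_⟩,
    fun q x s r hq0 hq1 hs hr => CyclicStat.hasSum_peak hq0 hq1 hs hr,
    fun q x r hq0 hq1 hr => CyclicStat.hasSum_valley hq0 hq1 hr⟩
  · exact (CyclicStat.peakPDE_iff _).2 CyclicStat.pdeOp_peakEGF
  · rw [CyclicStat.peakEGF_eq]
    exact CyclicStat.isInsertionStat_cpk.eq_derangementEGF ((CyclicStat.peakPDE_iff F).1 hF) h0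
  · exact (CyclicStat.valleyPDE_iff _).2 CyclicStat.pdeOp_valleyEGF
  · rw [CyclicStat.valleyEGF_eq]
    exact CyclicStat.isInsertionStat_cval.eq_derangementEGF ((CyclicStat.valleyPDE_iff F).1 hF) h0
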